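/- Let $d\ge 1$, let $\Omega\subset\mathbb R^d$ be a bounded open set, and let $\nu,T>0$. Write $\|\cdot\|_{L^2}$ for the norm of the real spaces $L^2(\Omega)$ and $L^2(\Omega;\mathbb R^d)$, and $\|v\|_{H^1_0}=\|\nabla v\|_{L^2}$ on $H_0^1(\Omega)$. There is a constant $C>0$, depending only on $\Omega$, $\nu$ and $T$ (hence on no discretization parameter), such that the following holds. Let $V^h\subset H_0^1(\Omega)$ be a finite-dimensional subspace, let $N\ge 2$ and $\Delta t=T/(N-1)$, let $f^2,\dots,f^N\in L^2(\Omega)$, and let $u^1,\dots,u^N\in V^h$ satisfy the backward Euler Galerkin scheme for the heat equation $$\Big(\tfrac{u^{n+1}-u^n}{\Delta t},v\Big)_{L^2}+\nu(\nabla u^{n+1},\nabla v)_{L^2}=(f^{n+1},v)_{L^2}\qquad\forall v\in V^h,\ 1\le n\le N-1 .$$ Put $\partial u^j=(u^{j+1}-u^j)/\Delta t$, and let $S=\mathbb R^N$ carry the weighted inner product $(g,h)_S=g^1h^1+\Delta t\sum_{j=2}^{N}g^jh^j$. Let $\lambda_1^{DQ1}\ge\dots\ge\lambda_N^{DQ1}\ge0$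 and $\varphi_1,\dots,\varphi_N\in L^2(\Omega)$ be the POD eigenvalues and modes for the POD space $X=L^2(\Omega)$; that is, $\{(\lambda_i^{DQ1})^{1/2},f_i,\varphi_i\}$ is a singular value decomposition, with suitable $S$-orthonormal $f_i$ and $L^2$-orthonormal $\varphi_i$, of the operator $$K_1:S\to L^2(\Omega),\qquad K_1g=g^1u^1+\sum_{j=1}^{N-1}\Delta t\,g^{j+1}\,\partial u^j .$$ Let $s$ be the number of positive eigenvalues $\lambda_i^{DQ1}$, let $0\le r\le N$ with $\varphi_1,\dots,\varphi_r\in V^h$ (automatic if $r\le s$), put $V_r^h=\operatorname{span}\{\varphi_1,\dots,\varphi_r\}$, and let $R_r$ be the Ritz projection onto $V_r^h$: for $w\in H_0^1(\Omega)$, $R_rw\in V_r^h$ and $(\nabla(w-R_rw),\nabla v_r)_{L^2}=0$ for all $v_r\in V_r^h$. Let $u_r^1,\dots,u_r^N\in V_r^h$ satisfy the reduced order model $$\Big(\tfrac{u_r^{n+1}-u_r^n}{\Delta t},v_r\Big)_{L^2}+\nu(\nabla u_r^{n+1},\nabla v_r)_{L^2}=(f^{n+1},v_r)_{L^2}\qquad\forall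 v_r\in V_r^h,\ 1\le n\le N-1,$$ with an arbitrary initial value $u_r^1\in V_r^h$ (for example the $L^2$-orthogonal projection of $u^1$ onto $V_r^h$). Then, with $e^n=u^n-u_r^n$ and $\phi_r^1=u_r^1-R_ru^1$, $$\|e^{N}\|_{L^2}^2+\nu\Delta t\sum_{n=1}^{N-1}\|\nabla e^{n+1}\|_{L^2}^2\le C\Big(\sum_{i=r+1}^{s}\lambda_i^{DQ1}\big(\|\varphi_i-R_r\varphi_i\|_{L^2}^2+\|\varphi_i-R_r\varphi_i\|_{H_0^1}^2\big)+\|\phi_r^1\|_{L^2}^2\Big).$$ -/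

import Mathlib

open MeasureTheory TopologicalSpace
open scoped InnerProductSpace Distributions Gradient

noncomputable section

namespace PodRom

/-- Euclidean space `ℝ^d`. -/
abbrev Space (d : ℕ) : Type := EuclideanSpace ℝ (Fin d)

/-- The real Hilbert space `L²(Ω)`, for Lebesgue measure on the open set `Ω ⊆ ℝ^d`. -/
abbrev L2 {d : ℕ} (Ω : Opens (Space d)) : Type :=
  Lp ℝ 2 (volume.restrict (Ω : Set (Space d)))

/-- The real Hilbert space `L²(Ω; ℝ^d)` of square integrable vector fields. -/
abbrev L2Vec {d : ℕ} (Ω : Opens (Space d)) : Type :=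
  Lp (Space d) 2 (volume.restrict (Ω : Set (Space d)))

section Sobolev

variable {d : ℕ} (Ω : Opens (Space d))

/-- `g ∈ L²(Ω; ℝ^d)` is the weak gradient of `u ∈ L²(Ω)`:
`∫_Ω u ∇ψ = - ∫_Ω ψ g` for all test functions `ψ ∈ C_c^∞(Ω)`. -/
def HasWeakGradient (u : L2 Ω) (g : L2Vec Ω) : Prop :=
  ∀ ψ : 𝓓(Ω, ℝ), ∫ x in (Ω : Set (Space d)), u x • ∇ ψ x =
    -∫ x in (Ω : Set (Space d)), ψ x • g x

/-- The pairs `(ψ, ∇ψ)`, `ψ ∈ C_c^∞(Ω)`, in `L²(Ω) × L²(Ω; ℝ^d)`. -/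
def testGraph : Set (L2 Ω × L2Vec Ω) :=
  {p | ∃ ψ : 𝓓(Ω, ℝ), p.1 =ᵐ[volume.restrict (Ω : Set (Space d))] ψ ∧
    p.2 =ᵐ[volume.restrict (Ω : Set (Space d))] ∇ ψ}

variable {Ω}

theorem test_gradient_continuous (ψ : 𝓓(Ω, ℝ)) : Continuous (∇ ψ) := by
  have h : Continuous (fderiv ℝ ψ) := ψ.contDiff.continuous_fderiv (by simp)
  exact (InnerProductSpace.toDual ℝ (Space d)).symm.continuous.comp h

theorem test_gradient_hasCompactSupport (ψ : 𝓓(Ω, ℝ)) : HasCompactSupport (∇ ψ) :=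
  (ψ.hasCompactSupport.fderiv ℝ).comp_left (map_zero _)

theorem integrable_smul_test_gradient (u : L2 Ω) (ψ : 𝓓(Ω, ℝ)) :
    Integrable (fun x => u x • ∇ ψ x) (volume.restrict (Ω : Set (Space d))) := by
  rw [← memLp_one_iff_integrable]
  exact MemLp.smul (p := 2) (q := 2)
    ((test_gradient_continuous ψ).memLp_of_hasCompactSupport
      (test_gradient_hasCompactSupport ψ)) (Lp.memLp u)

theorem integrable_test_smul (g : L2Vec Ω) (ψ : 𝓓(Ω, ℝ)) :
    Integrable (fun x => ψ x • g x) (volume.restrict (Ω : Set (Space d))) := by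
  rw [← memLp_one_iff_integrable]
  exact MemLp.smul (p := 2) (q := 2) (Lp.memLp g)
    (ψ.continuous.memLp_of_hasCompactSupport ψ.hasCompactSupport)

theorem HasWeakGradient.zero : HasWeakGradient Ω 0 0 := by
  intro ψ
  have h1 : ∫ x in (Ω : Set (Space d)), (0 : L2 Ω) x • ∇ ψ x = 0 := by
    refine integral_eq_zero_of_ae ?_
    filter_upwards [Lp.coeFn_zero ℝ 2 (volume.restrict (Ω : Set (Space d)))] with x hx
    rw [hx, Pi.zero_apply, zero_smul]; rfl
  have h2 : ∫ x in (Ω : Set (Space d)), ψ x • (0 : L2Vec Ω) x = 0 := by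
    refine integral_eq_zero_of_ae ?_
    filter_upwards [Lp.coeFn_zero (Space d) 2 (volume.restrict (Ω : Set (Space d)))] with x hx
    rw [hx, Pi.zero_apply, smul_zero]
  rw [h1, h2, neg_zero]

theorem HasWeakGradient.add {u v : L2 Ω} {g k : L2Vec Ω} (hu : HasWeakGradient Ω u g)
    (hv : HasWeakGradient Ω v k) : HasWeakGradient Ω (u + v) (g + k) := by
  intro ψ
  have h1 : ∫ x in (Ω : Set (Space d)), (u + v : L2 Ω) x • ∇ ψ x =
      (∫ x in (Ω : Set (Space d)), u x • ∇ ψ x) + ∫ x in (Ω : Set (Space d)), v x • ∇ ψ x := by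
    rw [← integral_add (integrable_smul_test_gradient u ψ) (integrable_smul_test_gradient v ψ)]
    refine integral_congr_ae ?_
    filter_upwards [Lp.coeFn_add u v] with x hx
    rw [hx, Pi.add_apply, add_smul]
  have h2 : ∫ x in (Ω : Set (Space d)), ψ x • (g + k : L2Vec Ω) x =
      (∫ x in (Ω : Set (Space d)), ψ x • g x) + ∫ x in (Ω : Set (Space d)), ψ x • k x := by
    rw [← integral_add (integrable_test_smul g ψ) (integrable_test_smul k ψ)]
    refine integral_congr_ae ?_
    filter_upwards [Lp.coeFn_add g k] with x hx
    rw [hx, Pi.add_apply, smul_add]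
  rw [h1, h2, hu ψ, hv ψ, neg_add]

theorem HasWeakGradient.smul (c : ℝ) {u : L2 Ω} {g : L2Vec Ω} (hu : HasWeakGradient Ω u g) :
    HasWeakGradient Ω (c • u) (c • g) := by
  intro ψ
  have h1 : ∫ x in (Ω : Set (Space d)), (c • u : L2 Ω) x • ∇ ψ x =
      c • ∫ x in (Ω : Set (Space d)), u x • ∇ ψ x := by
    rw [← integral_smul]
    refine integral_congr_ae ?_
    filter_upwards [Lp.coeFn_smul c u] with x hx
    simp [hx, mul_smul]
  have h2 : ∫ x in (Ω : Set (Space d)), ψ x • (c • g : L2Vec Ω) x =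
      c • ∫ x in (Ω : Set (Space d)), ψ x • g x := by
    rw [← integral_smul]
    refine integral_congr_ae ?_
    filter_upwards [Lp.coeFn_smul c g] with x hx
    simp [hx, smul_comm c]
  rw [h1, h2, hu ψ, smul_neg]

/-- The weak gradient is unique. -/
theorem HasWeakGradient.unique {u : L2 Ω} {g k : L2Vec Ω} (hg : HasWeakGradient Ω u g)
    (hk : HasWeakGradient Ω u k) : g = k := by
  have hloc : ∀ m : L2Vec Ω, LocallyIntegrableOn m (Ω : Set (Space d)) volume := by
    intro m
    rw [locallyIntegrableOn_iff Ω.isOpen.isLocallyClosed]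
    intro K hK hKc
    have h1 : MemLp m 2 (volume.restrict K) :=
      (Lp.memLp m).mono_measure (Measure.restrict_mono hK le_rfl)
    have : IsFiniteMeasure (volume.restrict K) := ⟨by simpa using hKc.measure_lt_top⟩
    exact h1.integrable (by norm_num)
  have h0 := IsOpen.ae_eq_zero_of_integral_contDiff_smul_eq_zero (μ := volume)
    (f := fun x => g x - k x) Ω.isOpen ((hloc g).sub (hloc k)) (by
      intro ψ h1 h2 h3
      let Ψ : 𝓓(Ω, ℝ) := ⟨ψ, h1, h2, h3⟩
      have hz : ∫ x in (Ω : Set (Space d)), ψ x • (g x - k x) = 0 := by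
        have e := (hg Ψ).symm.trans (hk Ψ)
        have e' : ∫ x in (Ω : Set (Space d)), Ψ x • g x =
          ∫ x in (Ω : Set (Space d)), Ψ x • k x := neg_injective e
        have := integral_sub (integrable_test_smul g Ψ) (integrable_test_smul k Ψ)
        rw [e', sub_self] at this
        simp only [smul_sub]
        exact this
      rw [← hz]
      refine (setIntegral_eq_integral_of_forall_compl_eq_zero ?_).symm
      intro x hx
      rw [image_eq_zero_of_notMem_tsupport (fun h => hx (h3 h)), zero_smul])
  refine Lp.ext ?_
  filter_upwards [(ae_restrict_iff' Ω.isOpen.measurableSet).2 h0] with x hx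
  exact sub_eq_zero.1 hx

theorem testGraph_zero : (0 : L2 Ω × L2Vec Ω) ∈ testGraph Ω := by
  refine ⟨0, ?_, ?_⟩
  · filter_upwards [Lp.coeFn_zero ℝ 2 (volume.restrict (Ω : Set (Space d)))] with x hx
    simpa using hx
  · filter_upwards [Lp.coeFn_zero (Space d) 2 (volume.restrict (Ω : Set (Space d)))] with x hx
    have h : (⇑(0 : 𝓓(Ω, ℝ))) = fun _ => (0 : ℝ) := by ext y; simp
    rw [h, gradient_fun_const]
    simpa using hx

theorem testGraph_add {p q : L2 Ω × L2Vec Ω} (hp : p ∈ testGraph Ω) (hq : q ∈ testGraph Ω) :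
    p + q ∈ testGraph Ω := by
  obtain ⟨ψ, h1, h2⟩ := hp
  obtain ⟨χ, h3, h4⟩ := hq
  refine ⟨ψ + χ, ?_, ?_⟩
  · filter_upwards [Lp.coeFn_add p.1 q.1, h1, h3] with x hx e1 e2
    rw [Prod.fst_add, hx, Pi.add_apply, e1, e2]; rfl
  · filter_upwards [Lp.coeFn_add p.2 q.2, h2, h4] with x hx e1 e2
    have h : ∇ (⇑(ψ + χ)) x = ∇ ψ x + ∇ χ x := by
      rw [FunLike.coe_add]
      unfold gradient
      rw [fderiv_add (ψ.contDiff.differentiable (by simp) x)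
        (χ.contDiff.differentiable (by simp) x), map_add]
    rw [h, ← e1, ← e2]
    simpa using hx

theorem testGraph_smul (c : ℝ) {p : L2 Ω × L2Vec Ω} (hp : p ∈ testGraph Ω) :
    c • p ∈ testGraph Ω := by
  obtain ⟨ψ, h1, h2⟩ := hp
  refine ⟨c • ψ, ?_, ?_⟩
  · filter_upwards [Lp.coeFn_smul c p.1, h1] with x hx e1
    simp [hx, e1]
  · filter_upwards [Lp.coeFn_smul c p.2, h2] with x hx e1
    have h : ∇ (⇑(c • ψ)) x = c • ∇ ψ x := by
      rw [FunLike.coe_smul]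
      unfold gradient
      rw [fderiv_const_smul (ψ.contDiff.differentiable (by simp) x)]
      simp
    rw [h, ← e1]
    simpa using hx

variable (Ω)

/-- The Sobolev space `H¹₀(Ω)`, as a subspace of `L²(Ω)`: the functions with a square integrable
weak gradient (that is, the elements of `H¹(Ω)`) that are limits of test functions in the norm
of `H¹(Ω)`. -/
def H10 : Submodule ℝ (L2 Ω) where
  carrier := {u | ∃ g : L2Vec Ω, HasWeakGradient Ω u g ∧ (u, g) ∈ closure (testGraph Ω)}
  zero_mem' := ⟨0, HasWeakGradient.zero, subset_closure testGraph_zero⟩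
  add_mem' := by
    rintro u v ⟨g, hg, hg'⟩ ⟨k, hk, hk'⟩
    exact ⟨g + k, hg.add hk,
      map_mem_closure₂ (f := fun p q : L2 Ω × L2Vec Ω => p + q) continuous_add hg' hk'
        (fun _ h1 _ h2 => testGraph_add h1 h2)⟩
  smul_mem' := by
    rintro c u ⟨g, hg, hg'⟩
    exact ⟨c • g, hg.smul c,
      map_mem_closure (f := fun p : L2 Ω × L2Vec Ω => c • p) (continuous_const_smul c) hg'
        (fun _ h1 => testGraph_smul c h1)⟩

open Classical in
/-- The weak gradient of `u ∈ H¹(Ω)` (and `0` if `u` has no square integrable weak gradient). -/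
def weakGrad (u : L2 Ω) : L2Vec Ω :=
  if h : ∃ g : L2Vec Ω, HasWeakGradient Ω u g then h.choose else 0

variable {Ω}

theorem HasWeakGradient.weakGrad_eq {u : L2 Ω} {g : L2Vec Ω} (h : HasWeakGradient Ω u g) :
    weakGrad Ω u = g := by
  have h' : ∃ g : L2Vec Ω, HasWeakGradient Ω u g := ⟨g, h⟩
  rw [weakGrad, dif_pos h']
  exact h'.choose_spec.unique h

variable (Ω)

open Classical in
/-- The Ritz projection of `w` onto a subspace `Vr` of `H¹₀(Ω)`: the element `v ∈ Vr` with
`(∇(w - v), ∇z)_{L²} = 0` for all `z ∈ Vr`. -/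
def ritzProj (Vr : Submodule ℝ (L2 Ω)) (w : L2 Ω) : L2 Ω :=
  if h : ∃ v ∈ Vr, ∀ z ∈ Vr, ⟪weakGrad Ω (w - v), weakGrad Ω z⟫_ℝ = 0 then h.choose else 0

/-- `u` at the times `1, …, N` is a backward Euler Galerkin solution, in the subspace `W` of
`H¹₀(Ω)`, of the heat equation with diffusion `ν`, time step `dt` and forcing `f`. -/
def IsBackwardEuler (W : Submodule ℝ (L2 Ω)) (ν dt : ℝ) (N : ℕ) (f u : ℕ → L2 Ω) : Prop :=
  (∀ n, 1 ≤ n → n ≤ N → u n ∈ W) ∧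
  ∀ n, 1 ≤ n → n < N → ∀ v ∈ W,
    ⟪dt⁻¹ • (u (n + 1) - u n), v⟫_ℝ + ν * ⟪weakGrad Ω (u (n + 1)), weakGrad Ω v⟫_ℝ =
      ⟪f (n + 1), v⟫_ℝ

end Sobolev

section Pod

variable {X : Type*} [NormedAddCommGroup X] [InnerProductSpace ℝ X]

/-- The weighted inner product `(g, h)_S = ∑ γ_j g_j h_j` on `S = ℝ^M`. -/
def weightedInner {M : ℕ} (γ g h : Fin M → ℝ) : ℝ := ∑ j, γ j * (g j * h j)

/-- The POD operator `K g = ∑ γ_j g_j w_j` of the weighted data `w`. -/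
def podOperator {M : ℕ} (γ : Fin M → ℝ) (w : Fin M → X) (g : Fin M → ℝ) : X :=
  ∑ j, (γ j * g j) • w j

/-- `lam` and `φ` are the POD eigenvalues (in non-increasing order) and POD modes of the weighted
data `w`: there are right singular vectors `f` such that `(√lam_k, f_k, φ_k)` is a singular value
decomposition of the POD operator. -/
structure IsPOD {M : ℕ} (γ : Fin M → ℝ) (w : Fin M → X) (lam : Fin M → ℝ) (φ : Fin M → X) :
    Prop where
  nonneg : ∀ k, 0 ≤ lam k
  antitone : Antitone lam
  orthonormal : Orthonormal ℝ φ
  exists_right : ∃ f : Fin M → Fin M → ℝ,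
    (∀ k l, weightedInner γ (f k) (f l) = if k = l then 1 else 0) ∧
    ∀ g, podOperator γ w g = ∑ k, (√(lam k) * weightedInner γ g (f k)) • φ k

/-- The number of positive POD eigenvalues. -/
def numPos {M : ℕ} (lam : Fin M → ℝ) : ℕ := (Finset.univ.filter fun k => 0 < lam k).card

/-- The span of the first `r` modes. -/
def podSpace {M : ℕ} (φ : Fin M → X) (r : ℕ) : Submodule ℝ X :=
  Submodule.span ℝ {x | ∃ k : Fin M, (k : ℕ) < r ∧ x = φ k}

/-- The data `u¹, ∂u¹, …, ∂u^{N-1}` with `∂u^j = (u^{j+1} - u^j) / dt`; the entry of index `j`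
is the `(j+1)`-st element of this list. -/
def dq1Data (dt : ℝ) (u : ℕ → X) (N : ℕ) (j : Fin N) : X :=
  if (j : ℕ) = 0 then u 1 else dt⁻¹ • (u (j + 1) - u j)

/-- The weights `1, dt, …, dt`. -/
def dq1Weight (dt : ℝ) (N : ℕ) (j : Fin N) : ℝ := if (j : ℕ) = 0 then 1 else dt

end Pod

end PodRom

end

namespace PodRom

/-! ### POD identities in inner product spaces -/

section Abstract

variable {X Y : Type*} [NormedAddCommGroup X] [InnerProductSpace ℝ X]
  [NormedAddCommGroup Y] [InnerProductSpace ℝ Y]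

/-! Write the error as `η - p`, with `η = u - R_r u` and `p = u_r - R_r u`. Ritz orthogonality
removes `∇η` from the error equation, so `p` solves a backward Euler scheme forced by `∂η`. Testing
with the new value of `p`, then using Poincaré and Young, bounds `p` by its initial value and `Δt ∑
‖∂η‖²` (`energy_estimate`).

The values of `η` and `∇η` are sums of their initial value and their increments, so Cauchy-Schwarz
bounds them by the initial value and the difference quotients, with a constant depending only on `T`
(`norm_sq_le_dq`).

What remains is `‖A u¹‖² + Δt ∑ ‖A ∂uʲ‖²` for `A = I - R_r` and `A = ∇(I - R_r)`. This equals `∑ λ_k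
‖A φ_k‖²` exactly (`IsPOD.sum_norm_sq_map`). The identity is algebraic, so `A` may be unbounded, and
it suffices to extend `∇` and `R_r` linearly to all of `L²`. -/

theorem podOperator_single {M : ℕ} (γ : Fin M → ℝ) (w : Fin M → X) (j : Fin M) :
    podOperator γ w (Pi.single j 1) = γ j • w j := by
  classical
  unfold podOperator
  rw [Finset.sum_eq_single j]
  · simp
  · intro b _ hb
    simp [Pi.single_eq_of_ne hb]
  · simp

theorem weightedInner_single {M : ℕ} (γ f : Fin M → ℝ) (j : Fin M) :
    weightedInner γ (Pi.single j 1) f = γ j * f j := by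
  classical
  unfold weightedInner
  rw [Finset.sum_eq_single j]
  · simp
  · intro b _ hb
    simp [Pi.single_eq_of_ne hb]
  · simp

/-- The decomposition evaluated at the `j`-th unit vector gives `γ j • w j`; the positive weight
then cancels. -/
theorem IsPOD.exists_expansion {M : ℕ} {γ : Fin M → ℝ} (hγ : ∀ j, 0 < γ j) {w : Fin M → X}
    {lam : Fin M → ℝ} {φ : Fin M → X} (h : IsPOD γ w lam φ) :
    ∃ f : Fin M → Fin M → ℝ,
      (∀ k l, weightedInner γ (f k) (f l) = if k = l then 1 else 0) ∧
      ∀ j, w j = ∑ k, (√(lam k) * f k j) • φ k := by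
  obtain ⟨f, hf, hK⟩ := h.exists_right
  refine ⟨f, hf, fun j => ?_⟩
  have h1 := hK (Pi.single j 1)
  simp only [podOperator_single, weightedInner_single] at h1
  apply smul_right_injective X (hγ j).ne'
  simp only [h1, Finset.smul_sum, smul_smul]
  refine Finset.sum_congr rfl fun k _ => ?_
  congr 1
  ring

/-- Expanding every datum in the modes gives a double sum over pairs of modes; summing over `j`
first, the orthonormality of the right singular vectors kills the cross terms, whatever `A` does to
the modes. -/
theorem IsPOD.sum_norm_sq_map {M : ℕ} {γ : Fin M → ℝ} (hγ : ∀ j, 0 < γ j) {w : Fin M → X}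
    {lam : Fin M → ℝ} {φ : Fin M → X} (h : IsPOD γ w lam φ) (A : X →ₗ[ℝ] Y) :
    ∑ j, γ j * ‖A (w j)‖ ^ 2 = ∑ k, lam k * ‖A (φ k)‖ ^ 2 := by
  obtain ⟨f, hf, hw⟩ := h.exists_expansion hγ
  have h1 : ∀ j, γ j * ‖A (w j)‖ ^ 2 =
      ∑ k, ∑ l, (√(lam k) * √(lam l) * ⟪A (φ k), A (φ l)⟫_ℝ) * (γ j * (f k j * f l j)) := by
    intro j
    rw [← real_inner_self_eq_norm_sq, hw j]
    simp only [map_sum, map_smul, sum_inner, inner_sum, inner_smul_left, inner_smul_right,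
      Finset.mul_sum, RCLike.conj_to_real]
    rw [Finset.sum_comm]
    refine Finset.sum_congr rfl fun k _ => Finset.sum_congr rfl fun l _ => ?_
    rw [real_inner_comm]
    ring
  simp only [h1]
  rw [Finset.sum_comm]
  refine Finset.sum_congr rfl fun k _ => ?_
  rw [Finset.sum_comm]
  have h2 : ∀ l, ∑ j, (√(lam k) * √(lam l) * ⟪A (φ k), A (φ l)⟫_ℝ) * (γ j * (f k j * f l j)) =
      (√(lam k) * √(lam l) * ⟪A (φ k), A (φ l)⟫_ℝ) * if k = l then 1 else 0 := by
    intro l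
    rw [← hf k l, weightedInner, Finset.mul_sum]
  simp only [h2, mul_ite, mul_one, mul_zero, Finset.sum_ite_eq, Finset.mem_univ, if_true]
  rw [Real.mul_self_sqrt (h.nonneg k), real_inner_self_eq_norm_sq]

/-- Since `K f_k = √λ_k φ_k`, a mode with positive eigenvalue is a combination of the data. -/
theorem IsPOD.mode_mem {M : ℕ} {γ : Fin M → ℝ} {w : Fin M → X}
    {lam : Fin M → ℝ} {φ : Fin M → X} (h : IsPOD γ w lam φ) {W : Submodule ℝ X}
    (hW : ∀ j, w j ∈ W) {k : Fin M} (hk : 0 < lam k) : φ k ∈ W := by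
  obtain ⟨f, hf, hK⟩ := h.exists_right
  have h1 : podOperator γ w (f k) = √(lam k) • φ k := by
    rw [hK, Finset.sum_eq_single k]
    · simp [hf]
    · intro b _ hb
      simp [hf, hb.symm]
    · simp
  have h2 : podOperator γ w (f k) ∈ W :=
    W.sum_mem fun j _ => W.smul_mem _ (hW j)
  rw [h1] at h2
  exact (W.smul_mem_iff (Real.sqrt_pos.2 hk).ne').1 h2

theorem IsPOD.eq_zero_of_numPos_le {M : ℕ} {γ : Fin M → ℝ} {w : Fin M → X}
    {lam : Fin M → ℝ} {φ : Fin M → X} (h : IsPOD γ w lam φ) {k : Fin M}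
    (hk : numPos lam ≤ k) : lam k = 0 := by
  by_contra h0
  have hpos : 0 < lam k := lt_of_le_of_ne (h.nonneg k) (Ne.symm h0)
  -- By monotonicity the `k + 1` indices up to `k` would all have positive eigenvalues.
  have h1 : Finset.Iic k ⊆ Finset.univ.filter fun k => 0 < lam k := by
    intro i hi
    simpa using hpos.trans_le (h.antitone (Finset.mem_Iic.1 hi))
  have h2 := Finset.card_le_card h1
  rw [Fin.card_Iic] at h2
  unfold numPos at hk
  omega

/-! ### Difference quotients and the discrete energy estimate -/

theorem sum_dq1 {dt : ℝ} (u : ℕ → X) (m : ℕ) (A : X →ₗ[ℝ] Y) :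
    ∑ j, dq1Weight dt (m + 1) j * ‖A (dq1Data dt u (m + 1) j)‖ ^ 2 =
      ‖A (u 1)‖ ^ 2 +
        dt * ∑ n ∈ Finset.range m, ‖dt⁻¹ • (A (u (n + 2)) - A (u (n + 1)))‖ ^ 2 := by
  rw [Fin.sum_univ_succ, Finset.sum_range, Finset.mul_sum]
  simp [dq1Weight, dq1Data]

/-- A sequence is controlled by its initial value and its difference quotients. -/
theorem norm_sq_le_dq {dt : ℝ} (hdt : 0 < dt) (y : ℕ → Y) {m k : ℕ} (hk : k ≤ m) :
    ‖y (k + 1)‖ ^ 2 ≤ 2 * (1 + m * dt) * (‖y 1‖ ^ 2 +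
      dt * ∑ n ∈ Finset.range m, ‖dt⁻¹ • (y (n + 2) - y (n + 1))‖ ^ 2) := by
  set q : ℕ → ℝ := fun n => ‖dt⁻¹ • (y (n + 2) - y (n + 1))‖ with hq
  have h1 : y (k + 1) = y 1 + ∑ n ∈ Finset.range k, (y (n + 2) - y (n + 1)) := by
    rw [Finset.sum_range_sub (fun n => y (n + 1))]
    simp
  have h2 : ‖y (k + 1)‖ ≤ ‖y 1‖ + dt * ∑ n ∈ Finset.range m, q n := by
    rw [h1]
    refine (norm_add_le _ _).trans (add_le_add le_rfl ?_)
    refine (norm_sum_le _ _).trans ?_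
    rw [Finset.mul_sum]
    calc ∑ n ∈ Finset.range k, ‖y (n + 2) - y (n + 1)‖
        = ∑ n ∈ Finset.range k, dt * q n := by
          refine Finset.sum_congr rfl fun n _ => ?_
          simp only [hq]
          rw [norm_smul, norm_inv, Real.norm_of_nonneg hdt.le, mul_inv_cancel_left₀ hdt.ne']
      _ ≤ ∑ n ∈ Finset.range m, dt * q n :=
          Finset.sum_le_sum_of_subset_of_nonneg (Finset.range_mono hk)
            fun n _ _ => by positivity
  -- Multiplied by `dt ^ 2`, the factor `m` from Cauchy-Schwarz becomes the total time `m * dt`.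
  have h3 : (∑ n ∈ Finset.range m, q n) ^ 2 ≤ m * ∑ n ∈ Finset.range m, q n ^ 2 := by
    simpa using sq_sum_le_card_mul_sum_sq (s := Finset.range m) (f := q)
  have hS : 0 ≤ ∑ n ∈ Finset.range m, q n ^ 2 := by positivity
  have h4 : ‖y (k + 1)‖ ^ 2 ≤ (‖y 1‖ + dt * ∑ n ∈ Finset.range m, q n) ^ 2 :=
    pow_le_pow_left₀ (norm_nonneg _) h2 2
  have h5 : (dt * ∑ n ∈ Finset.range m, q n) ^ 2 ≤
      m * dt * (dt * ∑ n ∈ Finset.range m, q n ^ 2) := by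
    rw [mul_pow]
    nlinarith [mul_le_mul_of_nonneg_left h3 (sq_nonneg dt)]
  have h6 : 0 ≤ m * dt * ‖y 1‖ ^ 2 := by positivity
  have h7 : 0 ≤ dt * ∑ n ∈ Finset.range m, q n ^ 2 := by positivity
  nlinarith [sq_nonneg (‖y 1‖ - dt * ∑ n ∈ Finset.range m, q n)]

/-- Energy estimate for the backward Euler scheme with right-hand side `∂η`. -/
theorem energy_estimate {Z : Type*} [NormedAddCommGroup Z] {ν dt c : ℝ} (hν : 0 < ν) (hdt : 0 < dt)
    (D : X → Z) (p η : ℕ → X) (m : ℕ)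
    (hP : ∀ n < m, ‖p (n + 2)‖ ≤ c * ‖D (p (n + 2))‖)
    (hp : ∀ n < m, ⟪dt⁻¹ • (p (n + 2) - p (n + 1)), p (n + 2)⟫_ℝ + ν * ‖D (p (n + 2))‖ ^ 2 =
      ⟪dt⁻¹ • (η (n + 2) - η (n + 1)), p (n + 2)⟫_ℝ) :
    ‖p (m + 1)‖ ^ 2 + ν * dt * ∑ n ∈ Finset.range m, ‖D (p (n + 2))‖ ^ 2 ≤
      ‖p 1‖ ^ 2 + c ^ 2 / ν *
        (dt * ∑ n ∈ Finset.range m, ‖dt⁻¹ • (η (n + 2) - η (n + 1))‖ ^ 2) := by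
  induction m with
  | zero => simp
  | succ m ih =>
    have ih := ih (fun n hn => hP n (by omega)) (fun n hn => hp n (by omega))
    rw [Finset.sum_range_succ, Finset.sum_range_succ]
    have e := hp m (by omega)
    have hPm := hP m (by omega)
    set q := dt⁻¹ • (η (m + 2) - η (m + 1))
    have hq : ⟪q, p (m + 2)⟫_ℝ ≤ ‖q‖ * (c * ‖D (p (m + 2))‖) :=
      (real_inner_le_norm _ _).trans (mul_le_mul_of_nonneg_left hPm (norm_nonneg _))
    -- Young's inequality weighted by `ν`: half of the dissipation absorbs the gradient term.
    have hy : ‖q‖ * (c * ‖D (p (m + 2))‖) ≤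
        c ^ 2 / ν * ‖q‖ ^ 2 / 2 + ν * ‖D (p (m + 2))‖ ^ 2 / 2 := by
      have : 0 ≤ (c * ‖q‖ - ν * ‖D (p (m + 2))‖) ^ 2 / (2 * ν) := by positivity
      have e2 : (c * ‖q‖ - ν * ‖D (p (m + 2))‖) ^ 2 / (2 * ν) =
        c ^ 2 / ν * ‖q‖ ^ 2 / 2 + ν * ‖D (p (m + 2))‖ ^ 2 / 2 -
          ‖q‖ * (c * ‖D (p (m + 2))‖) := by
        field_simp
        ring
      linarith
    rw [real_inner_smul_left, inner_sub_left, real_inner_self_eq_norm_sq] at e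
    have hc : ⟪p (m + 1), p (m + 2)⟫_ℝ ≤ (‖p (m + 1)‖ ^ 2 + ‖p (m + 2)‖ ^ 2) / 2 := by
      nlinarith [real_inner_le_norm (p (m + 1)) (p (m + 2)),
        sq_nonneg (‖p (m + 1)‖ - ‖p (m + 2)‖)]
    have e3 : ‖p (m + 2)‖ ^ 2 - ⟪p (m + 1), p (m + 2)⟫_ℝ + dt * (ν * ‖D (p (m + 2))‖ ^ 2) =
        dt * ⟪q, p (m + 2)⟫_ℝ := by
      rw [← e, mul_add, mul_inv_cancel_left₀ hdt.ne']
    have e4 := mul_le_mul_of_nonneg_left (hq.trans hy) hdt.le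
    have e5 : m + 1 + 1 = m + 2 := rfl
    rw [e5]
    linarith

end Abstract

/-! ### The Poincaré inequality on a bounded open set -/

section Poincare

variable {d : ℕ} {Ω : Opens (Space d)}

theorem inner_gradient_eq_fderiv {E : Type*} [NormedAddCommGroup E] [InnerProductSpace ℝ E]
    [CompleteSpace E] (ψ : E → ℝ) (x v : E) : ⟪∇ ψ x, v⟫_ℝ = fderiv ℝ ψ x v := by
  rw [gradient, InnerProductSpace.toDual_symm_apply]

/-- The Poincaré inequality for compactly supported functions, proved by multiplying by a linear
form and integrating by parts. -/
theorem integral_sq_le_of_hasCompactSupport {E : Type*} [NormedAddCommGroup E]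
    [InnerProductSpace ℝ E] [FiniteDimensional ℝ E] [MeasurableSpace E] [BorelSpace E]
    {ψ : E → ℝ} (hψ1 : ContDiff ℝ 1 ψ) (hc : HasCompactSupport ψ) (f : E →L[ℝ] ℝ) {v : E}
    (hfv : f v = 1) (hv : ‖v‖ ≤ 1) {R : ℝ} (hR : ∀ x, ψ x ≠ 0 → |f x| ≤ R) :
    ∫ x, ψ x ^ 2 ≤ 4 * R ^ 2 * ∫ x, ‖∇ ψ x‖ ^ 2 := by
  have hψ : Differentiable ℝ ψ := hψ1.differentiable (by simp)
  have hψc : Continuous ψ := hψ1.continuous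
  have hg : Continuous (∇ ψ) :=
    (InnerProductSpace.toDual ℝ E).symm.continuous.comp (hψ1.continuous_fderiv (by simp))
  have hgs : HasCompactSupport (∇ ψ) := (hc.fderiv ℝ).comp_left (map_zero _)
  have hd : ∀ x, fderiv ℝ (fun x => ψ x ^ 2) x v = 2 * ψ x * ⟪∇ ψ x, v⟫_ℝ := by
    intro x
    rw [inner_gradient_eq_fderiv, fderiv_fun_pow 2 (hψ x)]
    simp
  have hint : ∀ g : E → ℝ, Continuous g → (∀ x, ψ x = 0 → g x = 0) → Integrable g :=
    fun g h1 h2 => h1.integrable_of_hasCompactSupport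
      (hc.mono (Function.support_subset_iff'.2 fun x hx => h2 x (Function.notMem_support.1 hx)))
  have hi1 : Integrable fun x => ψ x ^ 2 :=
    hint _ (hψc.pow 2) fun x hx => by rw [hx]; simp
  have hi2 : Integrable fun x => f x * (2 * ψ x * ⟪∇ ψ x, v⟫_ℝ) :=
    hint _ (f.continuous.mul ((continuous_const.mul hψc).mul (hg.inner continuous_const)))
      fun x hx => by rw [hx]; ring
  have hi3 : Integrable fun x => f x * ψ x ^ 2 :=
    hint _ (f.continuous.mul (hψc.pow 2)) fun x hx => by rw [hx]; ring
  have hi4 : Integrable fun x => ‖∇ ψ x‖ ^ 2 :=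
    (hg.norm.pow 2).integrable_of_hasCompactSupport
      (hgs.mono (Function.support_subset_iff'.2 fun x hx => by
        simp [Function.notMem_support.1 hx]))
  -- Integration by parts along `v`, where the linear form `f` has derivative 1.
  have key : ∫ x, f x * (2 * ψ x * ⟪∇ ψ x, v⟫_ℝ) = -∫ x, ψ x ^ 2 := by
    have := integral_mul_fderiv_eq_neg_fderiv_mul_of_integrable (μ := volume)
      (f := f) (g := fun x => ψ x ^ 2) (v := v)
      (by simpa [hfv] using hi1) (by simpa only [hd] using hi2) hi3
      (fun x _ => f.differentiableAt) (fun x _ => (hψ x).pow 2)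
    simpa [hfv, hd] using this
  -- After integration the term `1 / 2 * ψ x ^ 2` is absorbed on the left, which doubles `2 * R ^
  -- 2`.
  have hpt : ∀ x, -(f x * (2 * ψ x * ⟪∇ ψ x, v⟫_ℝ)) ≤
      1 / 2 * ψ x ^ 2 + 2 * R ^ 2 * ‖∇ ψ x‖ ^ 2 := by
    intro x
    by_cases h0 : ψ x = 0
    · rw [h0]
      simp only [mul_zero, zero_mul, neg_zero, ne_eq, OfNat.ofNat_ne_zero, not_false_eq_true,
        zero_pow, zero_add]
      positivity
    · have h1 : |⟪∇ ψ x, v⟫_ℝ| ≤ ‖∇ ψ x‖ :=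
        (abs_real_inner_le_norm (∇ ψ x) v).trans (mul_le_of_le_one_right (norm_nonneg _) hv)
      have h3 : (f x * ⟪∇ ψ x, v⟫_ℝ) ^ 2 ≤ R ^ 2 * ‖∇ ψ x‖ ^ 2 := by
        rw [mul_pow]
        exact mul_le_mul (sq_le_sq.2 ((hR x h0).trans (le_abs_self R)))
          (sq_le_sq.2 (h1.trans (le_abs_self _))) (sq_nonneg _) (sq_nonneg _)
      nlinarith [sq_nonneg (ψ x + 2 * (f x * ⟪∇ ψ x, v⟫_ℝ))]
  have hle := integral_mono hi2.neg ((hi1.const_mul (1 / 2)).add (hi4.const_mul (2 * R ^ 2))) hpt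
  rw [integral_add' (hi1.const_mul (1 / 2)) (hi4.const_mul (2 * R ^ 2)), integral_const_mul,
    integral_const_mul] at hle
  simp only [Pi.neg_apply, integral_neg, key] at hle
  linarith

theorem norm_sq_eq_integral {E : Type*} [NormedAddCommGroup E] [InnerProductSpace ℝ E]
    {α : Type*} [MeasurableSpace α] {μ : Measure α} (f : Lp E 2 μ) :
    ‖f‖ ^ 2 = ∫ x, ‖f x‖ ^ 2 ∂μ := by
  rw [← real_inner_self_eq_norm_sq, L2.inner_def]
  simp only [real_inner_self_eq_norm_sq]

/-- Test functions and their gradients vanish off `Ω`, so both norms are integrals over the whole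
space, where the `i`-th coordinate serves as the linear form. -/
theorem norm_le_of_mem_testGraph {p : L2 Ω × L2Vec Ω} (hp : p ∈ testGraph Ω) (i : Fin d) {R : ℝ}
    (hR0 : 0 ≤ R) (hR : ∀ x ∈ (Ω : Set (Space d)), |x i| ≤ R) :
    ‖p.1‖ ≤ 2 * R * ‖p.2‖ := by
  obtain ⟨ψ, h1, h2⟩ := hp
  have e1 : ‖p.1‖ ^ 2 = ∫ x, ψ x ^ 2 := by
    rw [norm_sq_eq_integral, eq_comm, ← setIntegral_eq_integral_of_forall_compl_eq_zero
      (s := (Ω : Set (Space d)))]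
    · refine integral_congr_ae ?_
      filter_upwards [h1] with x hx
      simp [hx]
    · intro x hx
      rw [image_eq_zero_of_notMem_tsupport fun h => hx (ψ.tsupport_subset h)]
      simp
  have e2 : ‖p.2‖ ^ 2 = ∫ x, ‖∇ ψ x‖ ^ 2 := by
    rw [norm_sq_eq_integral, eq_comm, ← setIntegral_eq_integral_of_forall_compl_eq_zero
      (s := (Ω : Set (Space d)))]
    · refine integral_congr_ae ?_
      filter_upwards [h2] with x hx
      simp [hx]
    · intro x hx
      have h0 : fderiv ℝ ψ x = 0 := image_eq_zero_of_notMem_tsupport (f := fderiv ℝ ψ)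
        fun h => hx (ψ.tsupport_subset (tsupport_fderiv_subset ℝ h))
      simp [gradient, h0]
  refine abs_le_of_sq_le_sq' ?_ (by positivity) |>.2
  rw [mul_pow, mul_pow, e1, e2]
  have := integral_sq_le_of_hasCompactSupport (ψ.contDiff.of_le (by simp))
    ψ.hasCompactSupport (EuclideanSpace.proj i) (v := EuclideanSpace.single i 1) (by simp) (by simp)
    (fun x hx => hR x (by_contra fun h => hx
      (image_eq_zero_of_notMem_tsupport fun h' => h (ψ.tsupport_subset h'))))
  linarith

/-- **Poincaré inequality** on `H¹₀(Ω)`, for bounded `Ω`. -/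
theorem exists_poincare (hd : 1 ≤ d) (hΩ : Bornology.IsBounded (Ω : Set (Space d))) :
    ∃ c : ℝ, ∀ u ∈ H10 Ω, ‖u‖ ≤ c * ‖weakGrad Ω u‖ := by
  obtain ⟨R, hR⟩ := hΩ.exists_norm_le
  have hR' : ∀ x ∈ (Ω : Set (Space d)), |x ⟨0, hd⟩| ≤ max R 0 := fun x hx =>
    (PiLp.norm_apply_le x _).trans ((hR x hx).trans (le_max_left _ _))
  refine ⟨2 * max R 0, fun u hu => ?_⟩
  obtain ⟨g, hg, hcl⟩ := hu
  rw [hg.weakGrad_eq]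
  -- The inequality is a closed condition on pairs, so it passes from test functions to `H10 Ω`.
  have hclosed : IsClosed {p : L2 Ω × L2Vec Ω | ‖p.1‖ ≤ 2 * max R 0 * ‖p.2‖} :=
    isClosed_le continuous_fst.norm (continuous_const.mul continuous_snd.norm)
  have hsub : testGraph Ω ⊆ {p : L2 Ω × L2Vec Ω | ‖p.1‖ ≤ 2 * max R 0 * ‖p.2‖} :=
    fun p hp => norm_le_of_mem_testGraph hp ⟨0, hd⟩ (le_max_right _ _) hR'
  have hmem := closure_minimal hsub hclosed hcl
  rwa [Set.mem_ofPred_eq] at hmem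

end Poincare

/-! ### Linear extensions of the weak gradient and of the Ritz projection -/

section Ritz

variable {d : ℕ} {Ω : Opens (Space d)}

/-- The weak gradient on `H¹₀(Ω)` extends to a linear map on `L²(Ω)`. -/
theorem exists_linear_weakGrad (Ω : Opens (Space d)) :
    ∃ D : L2 Ω →ₗ[ℝ] L2Vec Ω, ∀ u ∈ H10 Ω, D u = weakGrad Ω u := by
  let D₀ : H10 Ω →ₗ[ℝ] L2Vec Ω :=
    { toFun := fun u => weakGrad Ω u
      map_add' := by
        rintro ⟨u, g, hg, hu⟩ ⟨v, k, hk, hv⟩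
        simp only [Submodule.coe_add]
        rw [hg.weakGrad_eq, hk.weakGrad_eq, (hg.add hk).weakGrad_eq]
      map_smul' := by
        rintro c ⟨u, g, hg, hu⟩
        simp only [Submodule.coe_smul, RingHom.id_apply]
        rw [hg.weakGrad_eq, (hg.smul c).weakGrad_eq] }
  obtain ⟨D, hD⟩ := D₀.exists_extend
  exact ⟨D, fun u hu => LinearMap.congr_fun hD ⟨u, hu⟩⟩

/-- The Ritz projection onto a finite-dimensional subspace of `H¹₀(Ω)` is given by a linear map. -/
theorem exists_linear_ritzProj {V : Submodule ℝ (L2 Ω)} [FiniteDimensional ℝ V] (hV : V ≤ H10 Ω)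
    {c : ℝ} (hc : ∀ u ∈ H10 Ω, ‖u‖ ≤ c * ‖weakGrad Ω u‖) {D : L2 Ω →ₗ[ℝ] L2Vec Ω}
    (hD : ∀ u ∈ H10 Ω, D u = weakGrad Ω u) :
    ∃ P : L2 Ω →ₗ[ℝ] L2 Ω, (∀ w ∈ H10 Ω, ritzProj Ω V w = P w) ∧ (∀ w, P w ∈ V) ∧
      (∀ w, ∀ z ∈ V, ⟪D (w - P w), D z⟫_ℝ = 0) ∧ ∀ w ∈ V, P w = w := by
  have hinj : ∀ z ∈ V, D z = 0 → z = 0 := by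
    intro z hz h0
    have h1 := hc z (hV hz)
    rw [← hD z (hV hz), h0, norm_zero, mul_zero] at h1
    exact norm_le_zero_iff.1 h1
  have hinj' : LinearMap.ker (D.domRestrict V) = ⊥ := by
    rw [LinearMap.ker_eq_bot']
    rintro ⟨z, hz⟩ h0
    exact Subtype.ext (hinj z hz h0)
  let e := LinearEquiv.ofInjective (D.domRestrict V) (LinearMap.ker_eq_bot.1 hinj')
  let U := LinearMap.range (D.domRestrict V)
  have : FiniteDimensional ℝ U := inferInstanceAs (FiniteDimensional ℝ (LinearMap.range _))
  -- By Poincaré `D` is injective on `V`: project `D w` orthogonally onto the image `D(V)`, then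
  -- pull back to `V`.
  let P : L2 Ω →ₗ[ℝ] L2 Ω :=
    V.subtype ∘ₗ e.symm.toLinearMap ∘ₗ U.orthogonalProjectionOnto.toLinearMap ∘ₗ D
  have hPV : ∀ w, P w ∈ V := fun w => (e.symm (U.orthogonalProjectionOnto (D w))).2
  have hDP : ∀ w, D (P w) = U.orthogonalProjectionOnto (D w) := by
    intro w
    have := congrArg Subtype.val (e.apply_symm_apply (U.orthogonalProjectionOnto (D w)))
    exact this
  have horth : ∀ w, ∀ z ∈ V, ⟪D (w - P w), D z⟫_ℝ = 0 := by
    intro w z hz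
    rw [map_sub, hDP]
    exact Submodule.starProjection_inner_eq_zero (K := U) (D w) (D z) ⟨⟨z, hz⟩, rfl⟩
  have huniq : ∀ w, ∀ v ∈ V, (∀ z ∈ V, ⟪D (w - v), D z⟫_ℝ = 0) → v = P w := by
    intro w v hv hz
    have hm : v - P w ∈ V := V.sub_mem hv (hPV w)
    refine sub_eq_zero.1 (hinj _ hm ?_)
    rw [← inner_self_eq_zero (𝕜 := ℝ)]
    have h1 := horth w _ hm
    have h2 := hz _ hm
    have h3 : D (v - P w) = D (w - P w) - D (w - v) := by
      rw [← map_sub]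
      congr 1
      abel
    nth_rewrite 1 [h3]
    rw [inner_sub_left, h1, h2, sub_zero]
  refine ⟨P, fun w hw => ?_, hPV, horth, fun w hw => ?_⟩
  · have hconv : ∀ v ∈ V, ∀ z ∈ V, ⟪weakGrad Ω (w - v), weakGrad Ω z⟫_ℝ =
        ⟪D (w - v), D z⟫_ℝ := fun v hv z hz => by
      rw [hD _ ((H10 Ω).sub_mem hw (hV hv)), hD _ (hV hz)]
    have hex : ∃ v ∈ V, ∀ z ∈ V, ⟪weakGrad Ω (w - v), weakGrad Ω z⟫_ℝ = 0 :=
      ⟨P w, hPV w, fun z hz => by rw [hconv _ (hPV w) z hz, horth w z hz]⟩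
    rw [ritzProj, dif_pos hex]
    obtain ⟨h1, h2⟩ := hex.choose_spec
    exact huniq w _ h1 fun z hz => by rw [← hconv _ h1 z hz, h2 z hz]
  · exact (huniq w w hw fun z _ => by rw [sub_self, map_zero, inner_zero_left]).symm

end Ritz

/-! ### Combining projection error and discrete error -/

section ErrorBound

variable {X Y : Type*} [NormedAddCommGroup X] [InnerProductSpace ℝ X]
  [NormedAddCommGroup Y] [InnerProductSpace ℝ Y]

theorem sq_norm_sub_le (a b : X) : ‖a - b‖ ^ 2 ≤ 2 * ‖a‖ ^ 2 + 2 * ‖b‖ ^ 2 := by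
  nlinarith [parallelogram_law_with_norm ℝ a b, sq_nonneg ‖a + b‖]

/-- Error splitting `e = η - p` into the projection error `η` and the discrete error `p`. -/
theorem error_estimate {ν dt c T : ℝ} (hν : 0 < ν) (hdt : 0 < dt)
    (D : X →ₗ[ℝ] Y) (p η : ℕ → X) {m : ℕ} (hm : 1 ≤ m) (hT : m * dt = T)
    (hP : ∀ n < m, ‖p (n + 2)‖ ≤ c * ‖D (p (n + 2))‖)
    (hp : ∀ n < m, ⟪dt⁻¹ • (p (n + 2) - p (n + 1)), p (n + 2)⟫_ℝ + ν * ‖D (p (n + 2))‖ ^ 2 =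
      ⟪dt⁻¹ • (η (n + 2) - η (n + 1)), p (n + 2)⟫_ℝ) :
    ‖η (m + 1) - p (m + 1)‖ ^ 2 +
        ν * dt * ∑ n ∈ Finset.range m, ‖D (η (n + 2) - p (n + 2))‖ ^ 2 ≤
      (4 * (1 + T) * (1 + ν * T) + 2 * (c ^ 2 / ν) + 2) *
        ((‖η 1‖ ^ 2 + dt * ∑ n ∈ Finset.range m, ‖dt⁻¹ • (η (n + 2) - η (n + 1))‖ ^ 2) +
          (‖D (η 1)‖ ^ 2 +
            dt * ∑ n ∈ Finset.range m, ‖dt⁻¹ • (D (η (n + 2)) - D (η (n + 1)))‖ ^ 2) +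
          ‖p 1‖ ^ 2) := by
  have hE := energy_estimate hν hdt D p η m hP hp
  have h0 := norm_sq_le_dq hdt η (le_refl m)
  set Q := dt * ∑ n ∈ Finset.range m, ‖dt⁻¹ • (η (n + 2) - η (n + 1))‖ ^ 2
  set Q' := dt * ∑ n ∈ Finset.range m, ‖dt⁻¹ • (D (η (n + 2)) - D (η (n + 1)))‖ ^ 2 with hQ'
  have hQ0 : 0 ≤ Q := by positivity
  have hQ'0 : 0 ≤ Q' := by positivity
  have hT0 : 0 ≤ T := by rw [← hT]; positivity
  have h1 : ∑ n ∈ Finset.range m, ‖D (η (n + 2))‖ ^ 2 ≤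
      m * (2 * (1 + T) * (‖D (η 1)‖ ^ 2 + Q')) := by
    have := Finset.sum_le_card_nsmul (Finset.range m) (fun n => ‖D (η (n + 2))‖ ^ 2)
      (2 * (1 + T) * (‖D (η 1)‖ ^ 2 + Q')) (fun n hn => by
        have := norm_sq_le_dq hdt (fun k => D (η k)) (m := m) (k := n + 1)
          (Finset.mem_range.1 hn)
        rwa [hT] at this)
    simpa using this
  have h2 : ∑ n ∈ Finset.range m, ‖D (η (n + 2) - p (n + 2))‖ ^ 2 ≤
      2 * ∑ n ∈ Finset.range m, ‖D (η (n + 2))‖ ^ 2 +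
        2 * ∑ n ∈ Finset.range m, ‖D (p (n + 2))‖ ^ 2 := by
    rw [Finset.mul_sum, Finset.mul_sum, ← Finset.sum_add_distrib]
    refine Finset.sum_le_sum fun n _ => ?_
    rw [map_sub]
    exact sq_norm_sub_le _ _
  have h3 := sq_norm_sub_le (η (m + 1)) (p (m + 1))
  rw [hT] at h0
  have h4 := mul_le_mul_of_nonneg_left h2 (mul_pos hν hdt).le
  have h5 := mul_le_mul_of_nonneg_left h1 (mul_pos hν hdt).le
  have h6 : ν * dt * (m * (2 * (1 + T) * (‖D (η 1)‖ ^ 2 + Q'))) =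
      2 * (1 + T) * (ν * T) * (‖D (η 1)‖ ^ 2 + Q') := by rw [← hT]; ring
  rw [h6] at h5
  obtain ⟨K, hK⟩ : ∃ K, K = c ^ 2 / ν := ⟨_, rfl⟩
  have hK0 : 0 ≤ K := by rw [hK]; positivity
  rw [← hK] at hE ⊢
  obtain ⟨A, hA⟩ : ∃ A, A = ‖η 1‖ ^ 2 := ⟨_, rfl⟩
  obtain ⟨B, hB⟩ : ∃ B, B = ‖D (η 1)‖ ^ 2 + Q' := ⟨_, rfl⟩
  obtain ⟨F, hF⟩ : ∃ F, F = ‖p 1‖ ^ 2 := ⟨_, rfl⟩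
  have hA0 : 0 ≤ A := by rw [hA]; positivity
  have hB0 : 0 ≤ B := by rw [hB]; positivity
  have hF0 : 0 ≤ F := by rw [hF]; positivity
  rw [← hA] at h0 ⊢
  rw [← hB] at h5 ⊢
  rw [← hF] at hE ⊢
  have hνT : 0 ≤ ν * T := by positivity
  obtain ⟨M, hM⟩ : ∃ M, M = ν * T := ⟨_, rfl⟩
  rw [← hM] at h5 hνT ⊢
  -- The left side collects, in order, the final value of `η`, the gradients of `η`, and twice the
  -- energy bound for `p`; each factor 2 lost in splitting `η - p` is included.
  have h7 : 4 * (1 + T) * (A + Q) + 4 * (1 + T) * M * B + 2 * F + 2 * (K * Q) ≤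
      (4 * (1 + T) * (1 + M) + 2 * K + 2) * (A + Q + B + F) := by
    have e : (4 * (1 + T) * (1 + M) + 2 * K + 2) * (A + Q + B + F) -
        (4 * (1 + T) * (A + Q) + 4 * (1 + T) * M * B + 2 * F + 2 * (K * Q)) =
        4 * (1 + T) * M * (A + Q + F) + 4 * (1 + T) * (B + F) + 2 * K * (A + B + F) +
          2 * (A + Q + B) := by ring
    have : 0 ≤ 4 * (1 + T) * M * (A + Q + F) + 4 * (1 + T) * (B + F) + 2 * K * (A + B + F) +
          2 * (A + Q + B) := by positivity
    linarith
  linarith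

end ErrorBound

end PodRom

/-! ### The main theorem -/

theorem mainTheorem7 (d : ℕ) (hd : 1 ≤ d) (Ω : TopologicalSpace.Opens (PodRom.Space d))
    (hΩ : Bornology.IsBounded (Ω : Set (PodRom.Space d)))
    (ν T : ℝ) (hν : 0 < ν) (hT : 0 < T) :
    -- the constant depends on `Ω`, `ν` and `T` only
    ∃ C : ℝ, 0 < C ∧
      ∀ (Vh : Submodule ℝ (PodRom.L2 Ω)), FiniteDimensional ℝ Vh → Vh ≤ PodRom.H10 Ω →
      ∀ (N : ℕ), 2 ≤ N → ∀ (dt : ℝ), dt = T / ((N : ℝ) - 1) →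
      -- the finite element solution
      ∀ (f u : ℕ → PodRom.L2 Ω), PodRom.IsBackwardEuler Ω Vh ν dt N f u →
      -- POD eigenvalues and modes
      ∀ (lam : Fin N → ℝ) (φ : Fin N → PodRom.L2 Ω),
        PodRom.IsPOD (PodRom.dq1Weight dt N) (PodRom.dq1Data dt u N) lam φ →
      ∀ (r : ℕ), r ≤ N → (∀ i : Fin N, (i : ℕ) < r → φ i ∈ Vh) →
      -- the reduced order model
      ∀ (ur : ℕ → PodRom.L2 Ω),
        PodRom.IsBackwardEuler Ω (PodRom.podSpace φ r) ν dt N f ur →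
      ‖u N - ur N‖ ^ 2 +
          ν * dt * ∑ n ∈ Finset.Icc 1 (N - 1),
            ‖PodRom.weakGrad Ω (u (n + 1) - ur (n + 1))‖ ^ 2 ≤
        C * ((∑ i ∈ Finset.univ.filter
              (fun i : Fin N => r ≤ (i : ℕ) ∧ (i : ℕ) < PodRom.numPos lam),
            lam i * (‖φ i - PodRom.ritzProj Ω (PodRom.podSpace φ r) (φ i)‖ ^ 2 +
              ‖PodRom.weakGrad Ω
                (φ i - PodRom.ritzProj Ω (PodRom.podSpace φ r) (φ i))‖ ^ 2)) +
          ‖ur 1 - PodRom.ritzProj Ω (PodRom.podSpace φ r) (u 1)‖ ^ 2) := by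
  open PodRom InnerProductSpace in
  obtain ⟨c, hc⟩ := exists_poincare hd hΩ
  obtain ⟨D, hD⟩ := exists_linear_weakGrad Ω
  refine ⟨4 * (1 + T) * (1 + ν * T) + 2 * (c ^ 2 / ν) + 2, by positivity, ?_⟩
  intro Vh hfin hVh N hN dt hdt f u hu lam φ hpod r hr hφ ur hur
  obtain ⟨m, rfl⟩ : ∃ m, N = m + 1 := ⟨N - 1, by omega⟩
  have hm : 1 ≤ m := by omega
  have hm0 : (0 : ℝ) < m := by exact_mod_cast hm
  have hdt' : dt = T / m := by rw [hdt]; push_cast; ring_nf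
  have hdt0 : 0 < dt := by rw [hdt']; positivity
  have hmT : m * dt = T := by rw [hdt']; field_simp
  set Vr := podSpace φ r with hVr
  have hVrVh : Vr ≤ Vh := by
    refine Submodule.span_le.2 ?_
    rintro x ⟨k, hk, rfl⟩
    exact hφ k hk
  have hfinr : FiniteDimensional ℝ Vr := Submodule.finiteDimensional_of_le hVrVh
  have hVrH : Vr ≤ H10 Ω := hVrVh.trans hVh
  obtain ⟨P, hritz, hPV, horth, hPid⟩ := exists_linear_ritzProj hVrH hc hD
  have huV : ∀ n, n ≤ m → u (n + 1) ∈ Vh := fun n hn => hu.1 (n + 1) (by omega) (by omega)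
  have hurV : ∀ n, n ≤ m → ur (n + 1) ∈ Vr := fun n hn => hur.1 (n + 1) (by omega) (by omega)
  have hγ : ∀ j, 0 < dq1Weight dt (m + 1) j := by
    intro j
    unfold dq1Weight
    split_ifs
    · exact one_pos
    · exact hdt0
  have hdata : ∀ j, dq1Data dt u (m + 1) j ∈ Vh := by
    intro j
    unfold dq1Data
    split_ifs with h
    · exact huV 0 (by omega)
    · refine Vh.smul_mem _ (Vh.sub_mem (huV _ (by omega)) ?_)
      have := huV ((j : ℕ) - 1) (by omega)
      rwa [Nat.sub_add_cancel (by omega)] at this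
  let Q : L2 Ω →ₗ[ℝ] L2 Ω := LinearMap.id - P
  have hQ : ∀ w, Q w = w - P w := fun w => rfl
  -- the modes outside the reduced space with a positive eigenvalue carry the projection error
  have hsum : (∑ k, lam k * ‖Q (φ k)‖ ^ 2) + ∑ k, lam k * ‖(D ∘ₗ Q) (φ k)‖ ^ 2 =
      ∑ i ∈ Finset.univ.filter (fun i : Fin (m + 1) => r ≤ (i : ℕ) ∧ (i : ℕ) < numPos lam),
        lam i * (‖φ i - ritzProj Ω Vr (φ i)‖ ^ 2 +
          ‖weakGrad Ω (φ i - ritzProj Ω Vr (φ i))‖ ^ 2) := by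
    rw [← Finset.sum_add_distrib, Finset.sum_filter]
    refine Finset.sum_congr rfl fun k _ => ?_
    -- A mode with zero eigenvalue may lie outside `H10 Ω`, where `D` and `P` are arbitrary
    -- extensions, but its term vanishes on both sides.
    rcases (hpod.nonneg k).eq_or_lt with h0 | h0
    · simp [← h0]
    · have hk : φ k ∈ H10 Ω := hVh (hpod.mode_mem hdata h0)
      have hks : (k : ℕ) < numPos lam := by
        by_contra h
        exact h0.ne' (hpod.eq_zero_of_numPos_le (not_lt.1 h))
      rw [LinearMap.comp_apply, hQ]
      split_ifs with h
      · rw [hritz _ hk, ← hD _ ((H10 Ω).sub_mem hk (hVrH (hPV _)))]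
        ring
      · have hkr : (k : ℕ) < r := by
          by_contra h'
          exact h ⟨not_lt.1 h', hks⟩
        -- The first `r` modes lie in the reduced space, so they have no projection error.
        rw [hPid _ (Submodule.subset_span ⟨k, hkr, rfl⟩)]
        simp
  rw [← hsum, ← hpod.sum_norm_sq_map hγ Q, ← hpod.sum_norm_sq_map hγ (D ∘ₗ Q), sum_dq1, sum_dq1,
    hritz _ (hVh (huV 0 (by omega)))]
  have hest := error_estimate (c := c) hν hdt0 D (fun n => ur n - P (u n)) (fun n => Q (u n)) hm hmT
    (by
      intro n hn
      have hmem : ur (n + 2) - P (u (n + 2)) ∈ H10 Ω :=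
        hVrH (Vr.sub_mem (hurV (n + 1) hn) (hPV _))
      simpa only [hD _ hmem] using hc _ hmem)
    (by
      intro n hn
      have hmem : ur (n + 2) - P (u (n + 2)) ∈ Vr := Vr.sub_mem (hurV (n + 1) hn) (hPV _)
      have e1 := hu.2 (n + 1) (by omega) (by omega) _ (hVrVh hmem)
      have e2 := hur.2 (n + 1) (by omega) (by omega) _ hmem
      have e3 := horth (u (n + 2)) _ hmem
      rw [← hD _ (hVrH hmem), ← hD _ (hVh (huV (n + 1) hn))] at e1
      rw [← hD _ (hVrH hmem), ← hD _ (hVrH (hurV (n + 1) hn))] at e2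
      simp only [hQ]
      rw [← real_inner_self_eq_norm_sq]
      generalize hz : ur (n + 2) - P (u (n + 2)) = z at *
      have e4 : ⟪D z, D z⟫_ℝ = ⟪D (ur (n + 2)), D z⟫_ℝ - ⟪D (P (u (n + 2))), D z⟫_ℝ := by
        rw [← inner_sub_left, ← map_sub, hz]
      have e5 : dt⁻¹ • (z - (ur (n + 1) - P (u (n + 1)))) =
          dt⁻¹ • (ur (n + 2) - ur (n + 1)) - dt⁻¹ • (P (u (n + 2)) - P (u (n + 1))) := by
        rw [← hz, ← smul_sub]
        congr 1
        abel
      have e6 : dt⁻¹ • (u (n + 2) - P (u (n + 2)) - (u (n + 1) - P (u (n + 1)))) =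
          dt⁻¹ • (u (n + 2) - u (n + 1)) - dt⁻¹ • (P (u (n + 2)) - P (u (n + 1))) := by
        rw [← smul_sub]
        congr 1
        abel
      rw [map_sub, inner_sub_left] at e3
      rw [e4, e5, e6, inner_sub_left, inner_sub_left]
      -- Ritz orthogonality: the diffusion terms of the two schemes then cancel, leaving only `∂η`
      -- as forcing.
      have e7 : ⟪D (P (u (n + 2))), D z⟫_ℝ = ⟪D (u (n + 2)), D z⟫_ℝ := by linarith
      rw [e7]
      have e8 : n + 1 + 1 = n + 2 := rfl
      rw [e8] at e1 e2
      linarith)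
  have herr : ∀ n, Q (u n) - (ur n - P (u n)) = u n - ur n := by
    intro n
    rw [hQ]
    abel
  simp only [herr] at hest
  have hgrad : ∑ n ∈ Finset.Icc 1 (m + 1 - 1), ‖weakGrad Ω (u (n + 1) - ur (n + 1))‖ ^ 2 =
      ∑ n ∈ Finset.range m, ‖D (u (n + 2) - ur (n + 2))‖ ^ 2 := by
    rw [Finset.range_eq_Ico, Finset.sum_Ico_add' (fun n => ‖D (u (n + 1) - ur (n + 1))‖ ^ 2) 0 m 1]
    refine Finset.sum_congr (by ext; simp) fun n hn => ?_
    have := Finset.mem_Ico.1 hn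
    rw [hD _ ((H10 Ω).sub_mem (hVh (huV n (by omega))) (hVrH (hurV n (by omega))))]
  rw [hgrad]
  exact hest
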